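/- Let $B_m$ denote the Bernoulli numbers, defined by $\frac{x}{e^x-1}=\sum_{m\ge0}\frac{B_m}{m!}x^m$ (so $B_1=-\tfrac12$); let $S_k^{(1)}(l)$ denote the (signed) Stirling numbers of the first kind, defined by $x(x+1)\cdots(x+k-1)=(-1)^k\sum_{l=0}^k(-1)^lS_k^{(1)}(l)\,x^l$; let $m!!$ denote the double factorial, extended to negative odd integers by $(m+2)!!=(m+2)\,m!!$ (so $(-1)!!=1$, $(-3)!!=-1$); and let $\zeta$ be the Riemann zeta function. For $k\ge1$ put $$a_k=(-1)^k\sum_{l=1}^k(-1)^l\frac{(2l-3)!!}{2^l(l+1)!}B_{l+1}S_k^{(1)}(l),\qquad b_k=(-1)^k\sum_{l=1}^k(-1)^l\frac{(2l-1)!!}{2^{l+1}(l+2)!}B_{l+2}S_k^{(1)}(l),$$ $$c_k=(-1)^k\sum_{l=1}^k(-1)^l\frac{(2l-5)!!}{2^{l-1}\,l!}B_{l}S_k^{(1)}(l).$$ Then for every integer $n\ge1$ the following three series converge (absolutely) and $$\sum_{k=0}^n\sqrt k=\frac23n^{3/2}+\frac12\sqrt n-\frac1{4\pi}\zeta\!\left(\tfrac32\right)+\sqrt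 n\sum_{k=1}^\infty\frac{a_k}{(n+1)(n+2)\cdots(n+k)},$$ $$\sum_{k=0}^n\sqrt k=\frac23n^{3/2}+\frac12\sqrt n-\frac1{4\pi}\zeta\!\left(\tfrac32\right)+\frac1{24\sqrt n}+\sum_{k=1}^\infty\frac{b_k}{\sqrt n\,(n+1)(n+2)\cdots(n+k)},$$ $$\sum_{k=0}^n\sqrt k=\frac23n^{3/2}-\frac1{4\pi}\zeta\!\left(\tfrac32\right)+n\sqrt n\sum_{k=1}^\infty\frac{c_k}{(n+1)(n+2)\cdots(n+k)}.$$ The first coefficients are $a_1=a_2=\frac1{24}$, $a_3=\frac{53}{640}$, $a_4=\frac{79}{320}$; $b_1=0$, $b_2=-\frac1{1920}$, $b_3=-\frac1{640}$, $b_4=-\frac{259}{46080}$, $b_5=-\frac{115}{4608}$; and $c_1=\frac12$, $c_2=\frac{13}{24}$, $c_3=\frac98$, $c_4=\frac{2213}{640}$. -/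

import Mathlib

namespace SqrtSum

/-- Double factorial `m!!` of an integer, extended to the negative odd integers by the recursion
`(m + 2)!! = (m + 2) * m!!`, so that `(-1)!! = 1` and `(-(2j+1))!! = (-1)^j / (2j-1)!!`.
On negative even integers it is not defined mathematically (here: `0`). -/
def dfac : ℤ → ℚ
  | Int.ofNat m => (Nat.doubleFactorial m : ℚ)
  | Int.negSucc m =>
      if Even m then (-1) ^ (m / 2) / (Nat.doubleFactorial (m - 1) : ℚ) else 0

/-- Signed Stirling numbers of the first kind `S_k^{(1)}(l)`. -/
def stirlingS (k l : ℕ) : ℤ := (-1) ^ (k + l) * (Nat.stirlingFirst k l : ℤ)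

/-- The defining recursion of the double factorial on all odd integers. -/
theorem dfac_add_two (m : ℤ) (hm : Odd m) : dfac (m + 2) = ((m + 2 : ℤ) : ℚ) * dfac m := by
  obtain ⟨j, rfl⟩ := hm
  rcases j with j | j
  · have h1 : (2 * Int.ofNat j + 1 + 2 : ℤ) = Int.ofNat (2 * j + 1 + 2) := by simp
    have h2 : (2 * Int.ofNat j + 1 : ℤ) = Int.ofNat (2 * j + 1) := by simp
    rw [h1, h2]
    simp only [dfac, Nat.doubleFactorial_add_two]
    simp only [Int.ofNat_eq_natCast]
    push_cast
    ring
  · rcases j with _ | i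
    · norm_num [dfac, Int.negSucc_eq]
      change dfac (Int.ofNat 1) = dfac (Int.negSucc 0)
      simp [dfac]
    · have h1 : (2 * Int.negSucc (i + 1) + 1 + 2 : ℤ) = Int.negSucc (2 * i) := by
        simp only [Int.negSucc_eq]; push_cast; ring
      have h2 : (2 * Int.negSucc (i + 1) + 1 : ℤ) = Int.negSucc (2 * i + 2) := by
        simp only [Int.negSucc_eq]; push_cast; ring
      rw [h1, h2]
      have e1 : Even (2 * i) := even_two_mul i
      have e2 : Even (2 * i + 2) := by simp [parity_simps]
      simp only [dfac, e1, e2, if_true]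
      have d1 : 2 * i / 2 = i := by omega
      have d2 : (2 * i + 2) / 2 = i + 1 := by omega
      have d3 : 2 * i + 2 - 1 = 2 * i + 1 := by omega
      rw [d1, d2, d3, Nat.doubleFactorial_add_one]
      have hpos : (Nat.doubleFactorial (2 * i - 1) : ℚ) ≠ 0 := by
        exact_mod_cast (Nat.doubleFactorial_pos _).ne'
      have hne : (2 * (i : ℚ) + 1) ≠ 0 := by positivity
      simp only [Int.negSucc_eq]
      push_cast
      field_simp
      ring

/-- The signed Stirling numbers are the connecting coefficients in
`x (x+1) ⋯ (x+k-1) = (-1)^k ∑_{l=0}^{k} (-1)^l S_k^{(1)}(l) x^l`. -/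
theorem ascPochhammer_eval_eq_sum_stirlingS (k : ℕ) (x : ℝ) :
    (ascPochhammer ℝ k).eval x =
      (-1) ^ k * ∑ l ∈ Finset.range (k + 1), (-1) ^ l * (stirlingS k l : ℝ) * x ^ l := by
  have key : ∀ k : ℕ, (ascPochhammer ℝ k).eval x =
      ∑ l ∈ Finset.range (k + 1), (Nat.stirlingFirst k l : ℝ) * x ^ l := by
    intro k
    induction k with
    | zero => simp
    | succ k ih =>
      rw [ascPochhammer_succ_eval, ih, Finset.sum_range_succ' _ (k + 1)]
      simp only [Nat.stirlingFirst_succ_succ, Nat.stirlingFirst_succ_zero]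
      push_cast
      simp only [add_mul, Finset.sum_add_distrib]
      have hA : ∑ l ∈ Finset.range (k + 1),
          (k : ℝ) * (Nat.stirlingFirst k (l + 1) : ℝ) * x ^ (l + 1) =
          k * ∑ l ∈ Finset.range (k + 1), (Nat.stirlingFirst k l : ℝ) * x ^ l := by
        have h := Finset.sum_range_succ'
          (fun l => (k : ℝ) * ((Nat.stirlingFirst k l : ℝ) * x ^ l)) (k + 1)
        rw [Finset.sum_range_succ, Nat.stirlingFirst_eq_zero_of_lt (Nat.lt_succ_self k)] at h
        rw [Finset.mul_sum]
        have h0 : (k : ℝ) * ((Nat.stirlingFirst k 0 : ℝ) * x ^ 0) = 0 := by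
          cases k <;> simp
        rw [h0] at h
        simp only [Nat.cast_zero, zero_mul, mul_zero, add_zero] at h
        rw [h]
        exact Finset.sum_congr rfl fun l _ => by ring
      have hB : ∑ l ∈ Finset.range (k + 1), (Nat.stirlingFirst k l : ℝ) * x ^ (l + 1) =
          (∑ l ∈ Finset.range (k + 1), (Nat.stirlingFirst k l : ℝ) * x ^ l) * x := by
        rw [Finset.sum_mul]
        exact Finset.sum_congr rfl fun l _ => by ring
      rw [hA, hB]
      ring
  rw [key, Finset.mul_sum]
  refine Finset.sum_congr rfl fun l _ => ?_
  have h : ((-1 : ℝ) ^ k * (-1) ^ k) = 1 := by rw [← mul_pow]; simp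
  have h' : ((-1 : ℝ) ^ l * (-1) ^ l) = 1 := by rw [← mul_pow]; simp
  simp only [stirlingS]
  push_cast
  rw [pow_add]
  linear_combination (-(Nat.stirlingFirst k l : ℝ) * x ^ l) * h * ((-1 : ℝ) ^ l * (-1) ^ l) -
    ((Nat.stirlingFirst k l : ℝ) * x ^ l) * h'

/-- `(-1)^k ∑_{l=1}^k (-1)^l (2l-3)!! / (2^l (l+1)!) B_{l+1} S_k^{(1)}(l)`. -/
def coeffA (k : ℕ) : ℚ :=
  (-1) ^ k * ∑ l ∈ Finset.Icc 1 k,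
    (-1) ^ l * (dfac (2 * (l : ℤ) - 3) / (2 ^ l * (Nat.factorial (l + 1) : ℚ))) *
      bernoulli (l + 1) * (stirlingS k l : ℚ)

/-- `(-1)^k ∑_{l=1}^k (-1)^l (2l-1)!! / (2^(l+1) (l+2)!) B_{l+2} S_k^{(1)}(l)`. -/
def coeffB (k : ℕ) : ℚ :=
  (-1) ^ k * ∑ l ∈ Finset.Icc 1 k,
    (-1) ^ l * (dfac (2 * (l : ℤ) - 1) / (2 ^ (l + 1) * (Nat.factorial (l + 2) : ℚ))) *
      bernoulli (l + 2) * (stirlingS k l : ℚ)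

/-- `(-1)^k ∑_{l=1}^k (-1)^l (2l-5)!! / (2^(l-1) l!) B_l S_k^{(1)}(l)`. -/
def coeffC (k : ℕ) : ℚ :=
  (-1) ^ k * ∑ l ∈ Finset.Icc 1 k,
    (-1) ^ l * (dfac (2 * (l : ℤ) - 5) / (2 ^ (l - 1) * (Nat.factorial l : ℚ))) *
      bernoulli l * (stirlingS k l : ℚ)

/-- `(n+1)(n+2)⋯(n+k)`. -/
def risingProd (n k : ℕ) : ℝ := ∏ j ∈ Finset.Icc 1 k, ((n : ℝ) + (j : ℝ))

/-- The real number `ζ(3/2)`. -/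
noncomputable def zetaThreeHalves : ℝ := (riemannZeta (3 / 2 : ℂ)).re

end SqrtSum

/-!
For `s ≠ 0` the kernel `1 / (1 - exp (-s)) - 1 / s - 1 / 2` is `2 s ∑ 1 / (s² + (2πm)²)`, summed
over `m ≥ 1`. Put `R x = π^(-1/2) ∫ exp (-x s) s^(-1/2) ∑ 1 / (s² + (2πm)²) ds`, the integral being
over `s > 0`. Multiplying the kernel by `1 - exp (-s)` leaves elementary functions, so
`R x - R (x + 1)` is the error of the trapezoidal rule for `√` on `[x, x + 1]`; the Mellin transform
of `1 / (s² + c²)` gives `R 0 = ζ(3/2) / (4π)`. Telescoping, `R n` is what the elementary terms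
miss.

Rescaling `s` in each summand gives `R x = √x ∫ x / (x² + u²) dν(u)`, where `ν` is a mixture of
gamma distributions whose even moments are multiples of zeta values at even integers, hence of
Bernoulli numbers. Now `x / (x² + u²)` is the real part of `1 / (x - i u)`, for which Waring's
series reads `1 / (x - z) = ∑ (z+1)⋯(z+k) / ((x+1)⋯(x+k+1))`, `k ≥ 0`. On the imaginary axis the
numerators are at most `k! exp (π |u| / 2)`, by the reflection formula for `Γ`, and `ν` decays like
`exp (-2π |u|)`; so one may integrate term by term, and expanding the numerators in powers of `z`
produces the Stirling numbers. This is the series in `a_k`. Integrating `i u / (x - i u)` instead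
gives `b_k`, and `c_k` follows from the recursion `c_{k+1} = k c_k + a_k`.
-/

open Filter Topology MeasureTheory ProbabilityTheory Set

namespace SqrtSum

/-! ### The coefficients -/

section StirlingSum

variable {R : Type*} [CommSemiring R]

/-- The Stirling transform `∑_{p=0}^k c(k+1, p+1) β p` of a sequence `β`, with the unsigned Stirling
numbers `c` of the first kind; the shift by one removes the vanishing numbers `c(k+1, 0)`. -/
def stirlingSum (β : ℕ → R) (k : ℕ) : R :=
  ∑ p ∈ Finset.range (k + 1), (Nat.stirlingFirst (k + 1) (p + 1) : R) * β p

theorem stirlingSum_succ (β : ℕ → R) (k : ℕ) :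
    stirlingSum β (k + 1) =
      (k + 1) * stirlingSum β k + stirlingSum (fun p => β (p + 1)) k := by
  have extend_range : ∑ p ∈ Finset.range (k + 2), (Nat.stirlingFirst (k + 1) (p + 1) : R) * β p =
      stirlingSum β k := by
    rw [Finset.sum_range_succ, Nat.stirlingFirst_eq_zero_of_lt (Nat.lt_succ_self (k + 1)),
      Nat.cast_zero, zero_mul, add_zero, stirlingSum]
  have shift_range : ∑ p ∈ Finset.range (k + 2), (Nat.stirlingFirst (k + 1) p : R) * β p =
      stirlingSum (fun p => β (p + 1)) k := by
    rw [Finset.sum_range_succ', Nat.stirlingFirst_succ_zero, Nat.cast_zero, zero_mul, add_zero,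
      stirlingSum]
  rw [← extend_range, ← shift_range, Finset.mul_sum, ← Finset.sum_add_distrib]
  refine Finset.sum_congr rfl fun p _ => ?_
  rw [Nat.stirlingFirst_succ_succ]
  push_cast
  ring

theorem stirlingSum_pow (z : R) (k : ℕ) :
    stirlingSum (fun p => z ^ p) k = (ascPochhammer R k).eval (z + 1) := by
  induction k with
  | zero => simp [stirlingSum, Nat.stirlingFirst]
  | succ k ih =>
    have shift : stirlingSum (fun p => z ^ (p + 1)) k = z * stirlingSum (fun p => z ^ p) k := by
      simp only [stirlingSum, Finset.mul_sum]
      exact Finset.sum_congr rfl fun p _ => by ring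
    rw [stirlingSum_succ, shift, ih, ascPochhammer_succ_eval]
    ring

end StirlingSum

theorem signed_sum_stirlingS_eq_stirlingSum (β : ℕ → ℚ) (k : ℕ) :
    (-1) ^ (k + 1) * ∑ l ∈ Finset.Icc 1 (k + 1), (-1) ^ l * β l * (stirlingS (k + 1) l : ℚ) =
      stirlingSum (fun p => β (p + 1)) k := by
  have reindex := Finset.sum_Ico_add' (fun l => (-1) ^ l * β l * (stirlingS (k + 1) l : ℚ))
    0 (k + 1) 1
  rw [← Finset.range_eq_Ico, zero_add, Finset.Ico_add_one_right_eq_Icc] at reindex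
  rw [← reindex, Finset.mul_sum, stirlingSum]
  refine Finset.sum_congr rfl fun p _ => ?_
  have sign_sq : ((-1 : ℚ) ^ (k + 1) * (-1) ^ (p + 1)) ^ 2 = 1 := by
    rw [← pow_add, ← pow_mul, mul_comm, pow_mul, neg_one_sq, one_pow]
  simp only [stirlingS]
  push_cast
  rw [pow_add (-1 : ℚ) (k + 1) (p + 1)]
  linear_combination (β (p + 1) * Nat.stirlingFirst (k + 1) (p + 1)) * sign_sq

/-- The coefficient `(2p-1)!! B_{p+2} / (2^(p+1) (p+2)!)` of `n^(-p-1)` in the asymptotic expansion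
of `∑_{k ≤ n} √k`, after subtraction of the main terms and division by `√n`. -/
def asymptoticCoeff (p : ℕ) : ℚ :=
  dfac (2 * (p : ℤ) - 1) / (2 ^ (p + 1) * (Nat.factorial (p + 2) : ℚ)) * bernoulli (p + 2)

theorem coeffA_succ (k : ℕ) : coeffA (k + 1) = stirlingSum asymptoticCoeff k := by
  simp only [coeffA, mul_assoc _ _ (bernoulli _)]
  rw [signed_sum_stirlingS_eq_stirlingSum
    (fun l => dfac (2 * (l : ℤ) - 3) / (2 ^ l * (Nat.factorial (l + 1) : ℚ)) * bernoulli (l + 1))]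
  congr 1
  funext p
  rw [asymptoticCoeff, show 2 * ((p + 1 : ℕ) : ℤ) - 3 = 2 * (p : ℤ) - 1 by push_cast; ring]

theorem coeffB_succ (k : ℕ) :
    coeffB (k + 1) = stirlingSum (fun p => asymptoticCoeff (p + 1)) k := by
  simp only [coeffB, mul_assoc _ _ (bernoulli _)]
  rw [signed_sum_stirlingS_eq_stirlingSum
    (fun l => dfac (2 * (l : ℤ) - 1) / (2 ^ (l + 1) * (Nat.factorial (l + 2) : ℚ)) *
      bernoulli (l + 2))]
  rfl

theorem dfac_natCast (m : ℕ) : dfac m = Nat.doubleFactorial m := rfl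

theorem dfac_neg_one : dfac (-1) = 1 := by
  change dfac (Int.negSucc 0) = 1
  simp [dfac]

theorem dfac_neg_three : dfac (-3) = -1 := by
  change dfac (Int.negSucc 2) = -1
  simp [dfac]

theorem coeffC_succ (k : ℕ) :
    coeffC (k + 1) = stirlingSum (fun p => Nat.casesOn p (1 / 2) asymptoticCoeff) k := by
  simp only [coeffC, mul_assoc _ _ (bernoulli _)]
  rw [signed_sum_stirlingS_eq_stirlingSum
    (fun l => dfac (2 * (l : ℤ) - 5) / (2 ^ (l - 1) * (Nat.factorial l : ℚ)) * bernoulli l)]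
  congr 1
  funext p
  cases p with
  | zero => norm_num [dfac_neg_three, bernoulli_one]
  | succ p =>
    simp only [asymptoticCoeff]
    rw [show 2 * ((p + 1 + 1 : ℕ) : ℤ) - 5 = 2 * (p : ℤ) - 1 by push_cast; ring]
    rfl

theorem coeffC_add_two (k : ℕ) : coeffC (k + 2) = (k + 1) * coeffC (k + 1) + coeffA (k + 1) := by
  rw [coeffC_succ, coeffC_succ, coeffA_succ, stirlingSum_succ]

theorem bernoulli_four : bernoulli 4 = -1 / 30 := by
  rw [bernoulli_eq_bernoulli'_of_ne_one (by decide), bernoulli'_four]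

theorem bernoulli_six : bernoulli 6 = 1 / 42 := by
  have recurrence := sum_bernoulli 7
  have bernoulli_three : bernoulli 3 = 0 := bernoulli_eq_zero_of_odd (by decide) (by decide)
  have bernoulli_five : bernoulli 5 = 0 := bernoulli_eq_zero_of_odd (by decide) (by decide)
  norm_num [Finset.sum_range_succ, bernoulli_one, bernoulli_two, bernoulli_three, bernoulli_four,
    bernoulli_five, Nat.choose] at recurrence
  linarith

theorem asymptoticCoeff_zero : asymptoticCoeff 0 = 1 / 24 := by
  norm_num [asymptoticCoeff, dfac_neg_one, bernoulli_two]

theorem asymptoticCoeff_two : asymptoticCoeff 2 = -1 / 1920 := by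
  have dfac_three : dfac 3 = 3 := dfac_natCast 3
  norm_num [asymptoticCoeff, dfac_three, bernoulli_four, Nat.factorial]

theorem asymptoticCoeff_of_odd {p : ℕ} (hp : Odd p) : asymptoticCoeff p = 0 := by
  rw [asymptoticCoeff, bernoulli_eq_zero_of_odd (hp.add_even even_two) (by lia), mul_zero]

theorem asymptoticCoeff_four : asymptoticCoeff 4 = 1 / 9216 := by
  have dfac_seven : dfac 7 = 105 := dfac_natCast 7
  norm_num [asymptoticCoeff, dfac_seven, bernoulli_six, Nat.factorial]

theorem coeffA_values :
    coeffA 1 = 1 / 24 ∧ coeffA 2 = 1 / 24 ∧ coeffA 3 = 53 / 640 ∧ coeffA 4 = 79 / 320 := by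
  norm_num [coeffA_succ, stirlingSum, Finset.sum_range_succ, Nat.stirlingFirst,
    asymptoticCoeff_zero, asymptoticCoeff_two, asymptoticCoeff_of_odd (show Odd 1 by decide),
    asymptoticCoeff_of_odd (show Odd 3 by decide)]

theorem coeffB_values :
    coeffB 1 = 0 ∧ coeffB 2 = -1 / 1920 ∧ coeffB 3 = -1 / 640 ∧ coeffB 4 = -259 / 46080 ∧
      coeffB 5 = -115 / 4608 := by
  norm_num [coeffB_succ, stirlingSum, Finset.sum_range_succ, Nat.stirlingFirst,
    asymptoticCoeff_two, asymptoticCoeff_four, asymptoticCoeff_of_odd (show Odd 1 by decide),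
    asymptoticCoeff_of_odd (show Odd 3 by decide), asymptoticCoeff_of_odd (show Odd 5 by decide)]

theorem coeffC_values :
    coeffC 1 = 1 / 2 ∧ coeffC 2 = 13 / 24 ∧ coeffC 3 = 9 / 8 ∧ coeffC 4 = 2213 / 640 := by
  obtain ⟨a₁, a₂, a₃, -⟩ := coeffA_values
  have c₁ : coeffC 1 = 1 / 2 := by norm_num [coeffC_succ, stirlingSum, Nat.stirlingFirst]
  have c₂ := coeffC_add_two 0
  have c₃ := coeffC_add_two 1
  have c₄ := coeffC_add_two 2
  norm_num [c₁, a₁] at c₂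
  norm_num [c₂, a₂] at c₃
  norm_num [c₃, a₃] at c₄
  exact ⟨c₁, c₂, c₃, c₄⟩

/-! ### Inverse factorial series -/

theorem sum_ascPochhammer_div_ascPochhammer {F : Type*} [Field F] {x z : F} (hxz : x ≠ z)
    (hx : ∀ k, (ascPochhammer F k).eval (x + 1) ≠ 0) (K : ℕ) :
    ∑ k ∈ Finset.range K,
        (ascPochhammer F k).eval (z + 1) / (ascPochhammer F (k + 1)).eval (x + 1) =
      (1 - (ascPochhammer F K).eval (z + 1) / (ascPochhammer F K).eval (x + 1)) / (x - z) := by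
  have hxz' : x - z ≠ 0 := sub_ne_zero.mpr hxz
  induction K with
  | zero => simp
  | succ K ih =>
    have hK := hx K
    have hfactor : x + 1 + K ≠ 0 := by
      have := hx (K + 1)
      rw [ascPochhammer_succ_eval] at this
      exact right_ne_zero_of_mul this
    rw [Finset.sum_range_succ, ih, ascPochhammer_succ_eval, ascPochhammer_succ_eval]
    field_simp
    ring

theorem ascPochhammer_eval_ofReal (k : ℕ) (x : ℝ) :
    (ascPochhammer ℂ k).eval (x : ℂ) =
      (((ascPochhammer ℝ k).eval x : ℝ) : ℂ) := by
  induction k with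
  | zero => simp
  | succ k ih => simp [ascPochhammer_succ_eval, ih]

section Denominators

variable {x : ℝ}

theorem ascPochhammer_add_one_pos (hx : 0 < x) (k : ℕ) : 0 < (ascPochhammer ℝ k).eval (x + 1) :=
  ascPochhammer_pos k _ (by positivity)

theorem summable_factorial_div_ascPochhammer (hx : 0 < x) :
    Summable fun k : ℕ => (k.factorial : ℝ) / (ascPochhammer ℝ (k + 1)).eval (x + 1) := by
  refine summable_of_sum_range_le (c := 1 / x)
    (fun k => div_nonneg (by positivity) (ascPochhammer_add_one_pos hx _).le) fun K => ?_
  have waring := sum_ascPochhammer_div_ascPochhammer hx.ne'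
    (fun k => (ascPochhammer_add_one_pos hx k).ne') K
  simp only [zero_add, ascPochhammer_eval_one, sub_zero] at waring
  rw [waring]
  gcongr
  exact sub_le_self _ (div_nonneg (by positivity) (ascPochhammer_add_one_pos hx _).le)

theorem tendsto_factorial_div_ascPochhammer (hx : 0 < x) :
    Tendsto (fun k : ℕ => (k.factorial : ℝ) / (ascPochhammer ℝ k).eval (x + 1)) atTop (𝓝 0) := by
  have prod_eq (k : ℕ) :
      ∏ j ∈ Finset.range (k + 1), (x + j) = x * (ascPochhammer ℝ k).eval (x + 1) := by
    induction k with
    | zero => simp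
    | succ k ih =>
      rw [Finset.prod_range_succ, ih, ascPochhammer_succ_eval]
      push_cast
      ring
  have lim : Tendsto (fun k : ℕ => x * (k : ℝ) ^ (-x) * Real.GammaSeq x k) atTop (𝓝 0) := by
    simpa using (((tendsto_rpow_neg_atTop hx).comp tendsto_natCast_atTop_atTop).const_mul x).mul
      (Real.GammaSeq_tendsto_Gamma x)
  refine lim.congr' ?_
  filter_upwards [eventually_gt_atTop 0] with k hk
  have hk' : (0 : ℝ) < k := by exact_mod_cast hk
  have := (ascPochhammer_add_one_pos hx k).ne'
  rw [Real.GammaSeq, prod_eq, Real.rpow_neg hk'.le]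
  field_simp

end Denominators

theorem sinh_div_self_le_exp_abs (y : ℝ) : Real.sinh y / y ≤ Real.exp |y| := by
  have of_nonneg {y : ℝ} (hy : 0 ≤ y) : Real.sinh y / y ≤ Real.exp y := by
    refine div_le_of_le_mul₀ hy (Real.exp_pos y).le ?_
    have exp_ge := Real.add_one_le_exp (-2 * y)
    have exp_mul_exp : Real.exp y * Real.exp (-2 * y) = Real.exp (-y) := by
      rw [← Real.exp_add]
      ring_nf
    rw [Real.sinh_eq]
    nlinarith [Real.exp_pos y]
  rcases abs_cases y with ⟨abs_eq, hy⟩ | ⟨abs_eq, hy⟩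
  · rw [abs_eq]
    exact of_nonneg hy
  · rw [abs_eq, ← neg_div_neg_eq, ← Real.sinh_neg]
    exact of_nonneg (by linarith)

theorem norm_Gamma_le_Gamma_re {z : ℂ} (hz : 0 < z.re) : ‖Complex.Gamma z‖ ≤ Real.Gamma z.re := by
  rw [Complex.Gamma_eq_integral hz, Real.Gamma_eq_integral hz, Complex.GammaIntegral]
  refine (norm_integral_le_integral_norm _).trans_eq (setIntegral_congr_fun measurableSet_Ioi ?_)
  intro t ht
  dsimp only
  rw [norm_mul, Complex.norm_real, Real.norm_eq_abs, Real.abs_exp,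
    Complex.norm_cpow_eq_rpow_re_of_pos ht, Complex.sub_re, Complex.one_re]

theorem norm_Gamma_mul_I_add_one_sq {u : ℝ} (hu : u ≠ 0) :
    ‖Complex.Gamma (u * Complex.I + 1)‖ ^ 2 = Real.pi * u / Real.sinh (Real.pi * u) := by
  have reflection := Complex.Gamma_mul_Gamma_one_sub (u * Complex.I)
  have conj_arg : 1 - u * Complex.I = starRingEnd ℂ (u * Complex.I + 1) := by
    simp [sub_eq_neg_add]
  have sin_eq : Complex.sin (Real.pi * (u * Complex.I)) =
      Real.sinh (Real.pi * u) * Complex.I := by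
    rw [← mul_assoc, Complex.sin_mul_I]
    push_cast
    rfl
  have hu' : (u : ℂ) * Complex.I ≠ 0 := by simp [hu]
  rw [← Complex.ofReal_inj]
  push_cast
  rw [← Complex.mul_conj', ← Complex.Gamma_conj, ← conj_arg, Complex.Gamma_add_one _ hu', mul_assoc,
    reflection, sin_eq]
  push_cast
  field_simp

theorem norm_ascPochhammer_mul_I_add_one_le (u : ℝ) (k : ℕ) :
    ‖(ascPochhammer ℂ k).eval (u * Complex.I + 1)‖ ≤
      k.factorial * Real.exp (Real.pi / 2 * |u|) := by
  rcases eq_or_ne u 0 with rfl | hu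
  · simp
  have not_pole (j : ℕ) : (u : ℂ) * Complex.I + 1 ≠ -j := fun h => by
    simpa [hu] using congrArg Complex.im h
  rw [← Complex.Gamma_add_nat_div_Gamma_eq _ not_pole, norm_div, div_eq_mul_inv]
  gcongr
  · have re_eq : ((u : ℂ) * Complex.I + 1 + k).re = k + 1 := by simp [add_comm]
    rw [← Real.Gamma_nat_eq_factorial, ← re_eq]
    exact norm_Gamma_le_Gamma_re (by rw [re_eq]; positivity)
  · rw [← pow_le_pow_iff_left₀ (by positivity) (by positivity) two_ne_zero, inv_pow,
      norm_Gamma_mul_I_add_one_sq hu, inv_div, ← Real.exp_nat_mul]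
    refine (sinh_div_self_le_exp_abs _).trans_eq ?_
    rw [abs_mul, abs_of_pos Real.pi_pos]
    push_cast
    ring_nf

theorem sub_mul_I_ne_zero {x : ℝ} (hx : 0 < x) (u : ℝ) : (x : ℂ) - u * Complex.I ≠ 0 :=
  fun h => hx.ne' (by simpa using congrArg Complex.re h)

theorem hasSum_ascPochhammer_mul_I_div {x : ℝ} (hx : 0 < x) (u : ℝ) :
    HasSum (fun k : ℕ => (ascPochhammer ℂ k).eval (u * Complex.I + 1) /
      (((ascPochhammer ℝ (k + 1)).eval (x + 1) : ℝ) : ℂ)) (1 / (x - u * Complex.I)) := by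
  have den_ne_zero (k : ℕ) : (((ascPochhammer ℝ k).eval (x + 1) : ℝ) : ℂ) ≠ 0 :=
    Complex.ofReal_ne_zero.mpr (ascPochhammer_add_one_pos hx k).ne'
  have norm_div_le (k m : ℕ) : ‖(ascPochhammer ℂ k).eval (u * Complex.I + 1) /
      (((ascPochhammer ℝ m).eval (x + 1) : ℝ) : ℂ)‖ ≤
      k.factorial / (ascPochhammer ℝ m).eval (x + 1) * Real.exp (Real.pi / 2 * |u|) := by
    have hm := ascPochhammer_add_one_pos hx m
    rw [norm_div, Complex.norm_of_nonneg hm.le, div_mul_eq_mul_div]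
    gcongr
    exact norm_ascPochhammer_mul_I_add_one_le u k
  have summable := Summable.of_norm_bounded
    ((summable_factorial_div_ascPochhammer hx).mul_right _) fun k => norm_div_le k (k + 1)
  have quotient_tendsto := squeeze_zero_norm (fun k => norm_div_le k k)
    (by simpa using (tendsto_factorial_div_ascPochhammer hx).mul_const _)
  have waring := sum_ascPochhammer_div_ascPochhammer (sub_ne_zero.mp (sub_mul_I_ne_zero hx u))
  simp only [← Complex.ofReal_one, ← Complex.ofReal_add, ascPochhammer_eval_ofReal] at waring
  rw [summable.hasSum_iff_tendsto_nat]
  refine Tendsto.congr (fun K => (waring den_ne_zero K).symm) ?_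
  simpa using (quotient_tendsto.const_sub 1).div_const (x - u * Complex.I)

theorem hasSum_integral_mul_ascPochhammer_div {μ : Measure ℝ} {h : ℝ → ℂ}
    (h_meas : AEStronglyMeasurable h μ)
    (h_int : Integrable (fun u => ‖h u‖ * Real.exp (Real.pi / 2 * |u|)) μ) {x : ℝ} (hx : 0 < x) :
    HasSum (fun k : ℕ => (∫ u, h u * (ascPochhammer ℂ k).eval (u * Complex.I + 1) ∂μ) /
      (((ascPochhammer ℝ (k + 1)).eval (x + 1) : ℝ) : ℂ)) (∫ u, h u / (x - u * Complex.I) ∂μ) := by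
  have norm_le (k : ℕ) (u : ℝ) : ‖h u * (ascPochhammer ℂ k).eval (u * Complex.I + 1)‖ ≤
      k.factorial * (‖h u‖ * Real.exp (Real.pi / 2 * |u|)) := by
    rw [norm_mul, mul_left_comm]
    gcongr
    exact norm_ascPochhammer_mul_I_add_one_le u k
  have term_int (k : ℕ) :
      Integrable (fun u => h u * (ascPochhammer ℂ k).eval (u * Complex.I + 1)) μ := by
    refine (h_int.const_mul (k.factorial : ℝ)).mono' (h_meas.mul ?_) (ae_of_all _ (norm_le k))
    fun_prop
  have pointwise (u : ℝ) : HasSum (fun k : ℕ => h u * (ascPochhammer ℂ k).eval (u * Complex.I + 1) /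
      (((ascPochhammer ℝ (k + 1)).eval (x + 1) : ℝ) : ℂ)) (h u / (x - u * Complex.I)) := by
    simpa only [mul_div_assoc, mul_one_div] using
      (hasSum_ascPochhammer_mul_I_div hx u).mul_left (h u)
  have hasSum := hasSum_integral_of_summable_integral_norm
    (fun k => (term_int k).div_const (((ascPochhammer ℝ (k + 1)).eval (x + 1) : ℝ) : ℂ)) ?_
  · simpa only [integral_div, (pointwise _).tsum_eq] using hasSum
  · refine Summable.of_nonneg_of_le (fun k => integral_nonneg fun u => norm_nonneg _) (fun k => ?_)
      ((summable_factorial_div_ascPochhammer hx).mul_right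
        (∫ u, ‖h u‖ * Real.exp (Real.pi / 2 * |u|) ∂μ))
    have hk := ascPochhammer_add_one_pos hx (k + 1)
    simp only [norm_div, Complex.norm_of_nonneg hk.le, integral_div]
    rw [div_mul_eq_mul_div, ← integral_const_mul]
    gcongr
    · exact (term_int k).norm
    · exact h_int.const_mul _
    · exact fun u => norm_le k u

section Recursion

variable {x : ℝ} {d s : ℕ → ℝ}

theorem summable_of_recursion (hx : 0 < x)
    (recursion : ∀ k : ℕ, (x + 1 + (k + 1 : ℕ)) * d (k + 1) = (k + 1) * d k + s k)
    (hs : Summable s) : Summable d := by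
  have partial_sum_le (K : ℕ) : x * ∑ k ∈ Finset.range K, |d k| + (x + 1 + K) * |d K| ≤
      (x + 1) * |d 0| + ∑ k ∈ Finset.range K, |s k| := by
    induction K with
    | zero => simp
    | succ K ih =>
      have step : (x + 1 + (K + 1 : ℕ)) * |d (K + 1)| ≤ (K + 1) * |d K| + |s K| := by
        have := abs_add_le ((K + 1) * d K) (s K)
        rwa [← recursion, abs_mul, abs_mul, abs_of_pos (by positivity : (0 : ℝ) < K + 1),
          abs_of_pos (by positivity : 0 < x + 1 + (K + 1 : ℕ))] at this
      rw [Finset.sum_range_succ, Finset.sum_range_succ]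
      linarith
  refine .of_abs (summable_of_sum_range_le (c := ((x + 1) * |d 0| + ∑' k, |s k|) / x)
    (fun k => abs_nonneg _) fun K => ?_)
  rw [le_div_iff₀' hx]
  have boundary_nonneg : 0 ≤ (x + 1 + K) * |d K| := by positivity
  linarith [partial_sum_le K, hs.abs.sum_le_tsum (Finset.range K) fun k _ => abs_nonneg _]

theorem eq_zero_of_tendsto_add_mul_of_summable {L : ℝ}
    (hL : Tendsto (fun k : ℕ => (x + k) * d k) atTop (𝓝 L)) (hd : Summable d) : L = 0 := by
  by_contra hL_ne
  have natCast_mul_tendsto : Tendsto (fun k : ℕ => k * d k) atTop (𝓝 L) := by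
    simpa [add_mul] using hL.sub (hd.tendsto_atTop_zero.const_mul x)
  have inv_isBigO : (fun k : ℕ => (k : ℝ)⁻¹) =O[atTop] d :=
    Asymptotics.isBigO_of_div_tendsto_nhds_of_ne_zero
      (natCast_mul_tendsto.congr fun k => by rw [div_inv_eq_mul, mul_comm]) hL_ne
  exact Real.not_summable_natCast_inv (summable_of_isBigO_nat hd inv_isBigO)

theorem hasSum_of_recursion {S : ℝ} (hx : 0 < x)
    (recursion : ∀ k : ℕ, (x + 1 + (k + 1 : ℕ)) * d (k + 1) = (k + 1) * d k + s k)
    (hs : HasSum s S) : HasSum d (((x + 1) * d 0 + S) / x) := by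
  have summable := summable_of_recursion hx recursion hs.summable
  have partial_sum (K : ℕ) : (x + 1) * d 0 + ∑ k ∈ Finset.range K, s k -
      x * ∑ k ∈ Finset.range K, d k = (x + 1 + K) * d K := by
    induction K with
    | zero => simp
    | succ K ih =>
      rw [Finset.sum_range_succ, Finset.sum_range_succ]
      linarith [recursion K]
  have boundary_tendsto := ((hs.tendsto_sum_nat.const_add ((x + 1) * d 0)).sub
    (summable.hasSum.tendsto_sum_nat.const_mul x)).congr partial_sum
  have boundary_zero := eq_zero_of_tendsto_add_mul_of_summable boundary_tendsto summable
  rw [← (eq_div_iff hx.ne').mpr (by linarith : (∑' k, d k) * x = (x + 1) * d 0 + S)]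
  exact summable.hasSum

theorem hasSum_div_ascPochhammer_of_recursion {a c : ℕ → ℝ} {S : ℝ} (hx : 0 < x)
    (recursion : ∀ k, c (k + 1) = (k + 1) * c k + a k)
    (ha : HasSum (fun k => a k / (ascPochhammer ℝ (k + 1)).eval (x + 1)) S) :
    HasSum (fun k => c k / (ascPochhammer ℝ (k + 1)).eval (x + 1)) ((c 0 + S) / x) := by
  convert! hasSum_of_recursion hx (fun k => ?_) ha using 2
  · have : x + 1 ≠ 0 := by positivity
    simp only [zero_add, ascPochhammer_one, Polynomial.eval_X]
    field_simp
  · have hk := (ascPochhammer_add_one_pos hx (k + 1)).ne'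
    have hfactor : x + 1 + (k + 1 : ℕ) ≠ 0 := by positivity
    rw [ascPochhammer_succ_eval (k + 1), recursion]
    field_simp

end Recursion

/-! ### The gamma distribution -/

section GammaDistribution

variable {a r : ℝ} {f : ℝ → ℝ}

theorem measurable_gammaPDF (a r : ℝ) : Measurable (gammaPDF a r) :=
  (measurable_gammaPDFReal a r).ennreal_ofReal

theorem gammaPDF_toReal_smul_eq_indicator (ha : 0 < a) (hr : 0 < r) :
    (fun u => (gammaPDF a r u).toReal • f u) =ᵐ[volume] (Ioi 0).indicator
      fun u => r ^ a / Real.Gamma a * (u ^ (a - 1) * Real.exp (-(r * u)) * f u) := by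
  filter_upwards [Measure.ae_ne volume (0 : ℝ)] with u hu
  rcases hu.lt_or_gt with hu | hu
  · rw [gammaPDF_of_neg hu, indicator_of_notMem (notMem_Ioi.mpr hu.le), ENNReal.toReal_zero,
      zero_smul]
  · have := Real.Gamma_pos_of_pos ha
    rw [gammaPDF_of_nonneg hu.le, indicator_of_mem (mem_Ioi.mpr hu),
      ENNReal.toReal_ofReal (by positivity), smul_eq_mul]
    ring

theorem integral_gammaMeasure (ha : 0 < a) (hr : 0 < r) :
    ∫ u, f u ∂gammaMeasure a r =
      r ^ a / Real.Gamma a * ∫ u in Ioi 0, u ^ (a - 1) * Real.exp (-(r * u)) * f u := by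
  rw [gammaMeasure, integral_withDensity_eq_integral_toReal_smul
    (measurable_gammaPDF a r) (ae_of_all _ fun _ => ENNReal.ofReal_lt_top),
    integral_congr_ae (gammaPDF_toReal_smul_eq_indicator ha hr),
    integral_indicator measurableSet_Ioi, integral_const_mul]

theorem integrable_gammaMeasure_iff (ha : 0 < a) (hr : 0 < r) :
    Integrable f (gammaMeasure a r) ↔
      IntegrableOn (fun u => u ^ (a - 1) * Real.exp (-(r * u)) * f u) (Ioi 0) := by
  have normalization_ne_zero : r ^ a / Real.Gamma a ≠ 0 :=
    div_ne_zero (Real.rpow_pos_of_pos hr a).ne' (Real.Gamma_pos_of_pos ha).ne'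
  rw [gammaMeasure, integrable_withDensity_iff_integrable_smul'
    (measurable_gammaPDF a r) (ae_of_all _ fun _ => ENNReal.ofReal_lt_top),
    integrable_congr (gammaPDF_toReal_smul_eq_indicator ha hr),
    integrable_indicator_iff measurableSet_Ioi, IntegrableOn, IntegrableOn,
    integrable_const_mul_iff normalization_ne_zero.isUnit]

theorem ae_pos_gammaMeasure (a r : ℝ) : ∀ᵐ u ∂gammaMeasure a r, 0 < u := by
  rw [gammaMeasure, ae_withDensity_iff (measurable_gammaPDF a r)]
  filter_upwards [Measure.ae_ne volume (0 : ℝ)] with u hu h_pdf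
  exact (not_lt.mp fun h => h_pdf (gammaPDF_of_neg h)).lt_of_ne' hu

theorem integral_pow_gammaMeasure (ha : 0 < a) (hr : 0 < r) (p : ℕ) :
    ∫ u, u ^ p ∂gammaMeasure a r = Real.Gamma (p + a) / Real.Gamma a / r ^ p := by
  have integrand {u : ℝ} (hu : u ∈ Ioi 0) : u ^ (a - 1) * Real.exp (-(r * u)) * u ^ p =
      u ^ (p + a - 1) * Real.exp (-(r * u)) := by
    rw [mul_right_comm, ← Real.rpow_natCast, ← Real.rpow_add hu]
    ring_nf
  rw [integral_gammaMeasure ha hr, setIntegral_congr_fun measurableSet_Ioi fun u => integrand,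
    Real.integral_rpow_mul_exp_neg_mul_Ioi (by positivity) hr, one_div, Real.inv_rpow hr.le,
    Real.rpow_add hr, Real.rpow_natCast]
  have := Real.Gamma_pos_of_pos ha
  field_simp

section MomentGeneratingFunction

variable {t : ℝ}

theorem rpow_mul_exp_neg_mul_mul_exp (u : ℝ) :
    u ^ (a - 1) * Real.exp (-(r * u)) * Real.exp (t * u) =
      u ^ (a - 1) * Real.exp (-((r - t) * u)) := by
  rw [mul_assoc, ← Real.exp_add]
  ring_nf

theorem integrable_exp_mul_gammaMeasure (ha : 0 < a) (hr : 0 < r) (ht : t < r) :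
    Integrable (fun u => Real.exp (t * u)) (gammaMeasure a r) := by
  simp only [integrable_gammaMeasure_iff ha hr, rpow_mul_exp_neg_mul_mul_exp]
  simpa only [Real.rpow_one, neg_mul] using integrableOn_rpow_mul_exp_neg_mul_rpow
    (by linarith : -1 < a - 1) one_pos (sub_pos.mpr ht)

theorem mgf_id_gammaMeasure (ha : 0 < a) (hr : 0 < r) (ht : t < r) :
    mgf id (gammaMeasure a r) t = (r / (r - t)) ^ a := by
  simp only [mgf, id, integral_gammaMeasure ha hr, rpow_mul_exp_neg_mul_mul_exp]
  have hrt := sub_pos.mpr ht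
  rw [Real.integral_rpow_mul_exp_neg_mul_Ioi ha hrt, Real.div_rpow hr.le hrt.le, one_div,
    Real.inv_rpow hrt.le]
  have := Real.Gamma_pos_of_pos ha
  field_simp

end MomentGeneratingFunction

theorem integral_comp_mul_gammaMeasure (ha : 0 < a) (hr : 0 < r) {c : ℝ} (hc : 0 < c) :
    ∫ u, f (c * u) ∂gammaMeasure a (c * r) = ∫ u, f u ∂gammaMeasure a r := by
  have integrand {u : ℝ} (hu : u ∈ Ioi 0) :
      u ^ (a - 1) * Real.exp (-(c * r * u)) * f (c * u) =
      (c ^ (a - 1))⁻¹ * ((c * u) ^ (a - 1) * Real.exp (-(r * (c * u))) * f (c * u)) := by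
    rw [Real.mul_rpow hc.le (le_of_lt hu)]
    field_simp
  rw [integral_gammaMeasure ha hr, integral_gammaMeasure ha (mul_pos hc hr),
    setIntegral_congr_fun measurableSet_Ioi fun u => integrand, integral_const_mul,
    integral_comp_mul_left_Ioi (fun v => v ^ (a - 1) * Real.exp (-(r * v)) * f v) 0 hc, mul_zero,
    Real.mul_rpow hc.le hr.le, Real.rpow_sub_one hc.ne', smul_eq_mul]
  field_simp

end GammaDistribution

/-! ### The spectral measure -/

/-- The nonzero poles of `s ↦ 1 / (1 - exp (-s))` are `± i freq m`, `m ∈ ℕ`. -/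
noncomputable def freq (m : ℕ) : ℝ := 2 * Real.pi * (m + 1)

theorem two_pi_le_freq (m : ℕ) : 2 * Real.pi ≤ freq m :=
  le_mul_of_one_le_right (by positivity) (by simp)

theorem freq_pos (m : ℕ) : 0 < freq m := by
  rw [freq]
  positivity

theorem summable_inv_freq_sq : Summable fun m => (freq m ^ 2)⁻¹ := by
  have squares := (summable_nat_add_iff 1).mpr (Real.summable_nat_pow_inv.mpr one_lt_two)
  simpa only [freq, mul_pow _ _ 2, mul_inv, Nat.cast_add_one] using squares.mul_left _

/-- The measure `ν` whose even moments are, up to sign, the nonzero `asymptoticCoeff p`: a mixture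
of gamma distributions of shape `1/2`, whose rates are the moduli of the poles of
`s ↦ 1 / (1 - exp (-s))`. -/
noncomputable def spectralMeasure : Measure ℝ :=
  Measure.sum fun m => ENNReal.ofReal (freq m ^ 2)⁻¹ • gammaMeasure (1 / 2) (freq m)

section SpectralMeasure

variable {f : ℝ → ℝ}

theorem integral_smul_gammaMeasure_freq (m : ℕ) :
    ∫ u, f u ∂(ENNReal.ofReal (freq m ^ 2)⁻¹ • gammaMeasure (1 / 2) (freq m)) =
      (freq m ^ 2)⁻¹ * ∫ u, f u ∂gammaMeasure (1 / 2) (freq m) := by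
  rw [integral_smul_measure, ENNReal.toReal_ofReal (by positivity), smul_eq_mul]

theorem hasSum_integral_spectralMeasure (hf : Integrable f spectralMeasure) :
    HasSum (fun m => (freq m ^ 2)⁻¹ * ∫ u, f u ∂gammaMeasure (1 / 2) (freq m))
      (∫ u, f u ∂spectralMeasure) := by
  simp only [← integral_smul_gammaMeasure_freq]
  exact hasSum_integral_measure hf

theorem ae_pos_spectralMeasure : ∀ᵐ u ∂spectralMeasure, 0 < u :=
  Measure.ae_sum_iff.mpr fun _ => Measure.ae_smul_measure (ae_pos_gammaMeasure _ _) _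

theorem mgf_id_gammaMeasure_freq_le {t : ℝ} (ht : |t| < 2 * Real.pi) (m : ℕ) :
    mgf id (gammaMeasure (1 / 2) (freq m)) t ≤
      (2 * Real.pi / (2 * Real.pi - |t|)) ^ (1 / 2 : ℝ) := by
  have hm := two_pi_le_freq m
  have ht_lt : t < freq m := by linarith [le_abs_self t]
  have hsub := sub_pos.mpr ht_lt
  have hm_pos := freq_pos m
  rw [mgf_id_gammaMeasure one_half_pos hm_pos ht_lt]
  gcongr ?_ ^ _
  rw [div_le_div_iff₀ hsub (sub_pos.mpr ht)]
  nlinarith [mul_le_mul_of_nonneg_right hm (abs_nonneg t), le_abs_self t, Real.pi_pos]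

theorem integrable_exp_mul_spectralMeasure {t : ℝ} (ht : |t| < 2 * Real.pi) :
    Integrable (fun u => Real.exp (t * u)) spectralMeasure := by
  refine integrable_sum_measure (fun m => ?_) ?_
  · exact (integrable_exp_mul_gammaMeasure one_half_pos (freq_pos m)
      (by linarith [le_abs_self t, two_pi_le_freq m])).smul_measure ENNReal.ofReal_ne_top
  · simp only [integral_smul_gammaMeasure_freq, Real.norm_of_nonneg (Real.exp_nonneg _)]
    refine Summable.of_nonneg_of_le (fun m => ?_) (fun m => ?_) (summable_inv_freq_sq.mul_right
      ((2 * Real.pi / (2 * Real.pi - |t|)) ^ (1 / 2 : ℝ)))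
    · exact mul_nonneg (by positivity) (integral_nonneg fun u => (Real.exp_pos _).le)
    · gcongr
      exact mgf_id_gammaMeasure_freq_le ht m

theorem mem_interior_integrableExpSet_spectralMeasure {t : ℝ} (ht : |t| < 2 * Real.pi) :
    t ∈ interior (integrableExpSet id spectralMeasure) :=
  interior_mono (fun _ hs => integrable_exp_mul_spectralMeasure hs)
    ((isOpen_lt continuous_abs continuous_const).subset_interior_iff.mpr subset_rfl ht)

theorem integrable_pow_mul_exp_spectralMeasure (p : ℕ) {t : ℝ} (ht : |t| < 2 * Real.pi) :
    Integrable (fun u => |u| ^ p * Real.exp (t * |u|)) spectralMeasure :=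
  (integrable_pow_mul_exp_of_mem_interior_integrableExpSet
    (mem_interior_integrableExpSet_spectralMeasure ht) p).congr <| by
    filter_upwards [ae_pos_spectralMeasure] with u hu
    rw [abs_of_pos hu, id]

theorem integrable_pow_spectralMeasure (p : ℕ) : Integrable (fun u => u ^ p) spectralMeasure :=
  integrable_pow_of_mem_interior_integrableExpSet
    (mem_interior_integrableExpSet_spectralMeasure (by simp [Real.pi_pos])) p

end SpectralMeasure

theorem hasSum_integral_pow_spectralMeasure (p : ℕ) :
    HasSum (fun m : ℕ => Nat.doubleFactorial (2 * p - 1) / (2 ^ p * (2 * Real.pi) ^ (p + 2)) *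
      (1 / ((m + 1 : ℕ) : ℝ) ^ (p + 2))) (∫ u, u ^ p ∂spectralMeasure) := by
  refine (hasSum_integral_spectralMeasure (integrable_pow_spectralMeasure p)).congr_fun fun m => ?_
  rw [integral_pow_gammaMeasure one_half_pos (freq_pos m), Real.Gamma_nat_add_half,
    Real.Gamma_one_half_eq, freq, Nat.cast_add_one]
  field_simp
  rw [mul_pow, mul_pow]
  ring

theorem dfac_two_mul_sub_one (p : ℕ) : dfac (2 * p - 1) = Nat.doubleFactorial (2 * p - 1) := by
  cases p with
  | zero => exact dfac_neg_one
  | succ p =>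
    rw [← dfac_natCast]
    congr 1
    lia

theorem integral_pow_two_mul_spectralMeasure (q : ℕ) :
    ∫ u, u ^ (2 * q) ∂spectralMeasure = (-1) ^ q * asymptoticCoeff (2 * q) := by
  have zeta := (hasSum_nat_add_iff' 1).mpr (hasSum_zeta_nat q.succ_ne_zero)
  simp only [Finset.sum_range_one, Nat.cast_zero, zero_pow (mul_ne_zero two_ne_zero q.succ_ne_zero),
    div_zero, sub_zero] at zeta
  have moments := hasSum_integral_pow_spectralMeasure (2 * q)
  have value_eq := (zeta.mul_left _).unique moments
  rw [← value_eq, asymptoticCoeff, dfac_two_mul_sub_one, Nat.succ_eq_add_one, mul_add_one,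
    Nat.add_sub_assoc one_le_two, mul_pow _ _ (2 * q + 2)]
  push_cast
  field_simp
  ring

theorem re_integral_mul_I_pow_spectralMeasure (p : ℕ) :
    (∫ u : ℝ, (u * Complex.I) ^ p ∂spectralMeasure).re = asymptoticCoeff p := by
  simp only [mul_pow, ← Complex.ofReal_pow, integral_mul_const]
  rw [integral_complex_ofReal, Complex.re_ofReal_mul]
  rcases p.even_or_odd' with ⟨q, rfl | rfl⟩
  · have I_pow : Complex.I ^ (2 * q) = ((-1 : ℝ) ^ q : ℝ) := by simp [pow_mul]
    rw [I_pow, Complex.ofReal_re, integral_pow_two_mul_spectralMeasure, mul_right_comm, ← mul_pow]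
    simp
  · have I_pow : Complex.I ^ (2 * q + 1) = ((-1 : ℝ) ^ q : ℝ) * Complex.I := by
      simp [pow_succ, pow_mul]
    rw [I_pow, Complex.re_ofReal_mul, asymptoticCoeff_of_odd (odd_two_mul_add_one q)]
    simp

theorem integrable_mul_I_pow_spectralMeasure (p : ℕ) :
    Integrable (fun u : ℝ => (u * Complex.I) ^ p) spectralMeasure := by
  simp only [mul_pow, ← Complex.ofReal_pow]
  exact (integrable_pow_spectralMeasure p).ofReal.mul_const _

theorem re_integral_mul_I_pow_mul_ascPochhammer_spectralMeasure (r k : ℕ) :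
    (∫ u : ℝ, (u * Complex.I) ^ r * (ascPochhammer ℂ k).eval (u * Complex.I + 1)
      ∂spectralMeasure).re = (stirlingSum (fun p => asymptoticCoeff (p + r)) k : ℚ) := by
  simp only [← stirlingSum_pow, stirlingSum, Finset.mul_sum, mul_left_comm _ (Nat.cast _),
    ← pow_add, add_comm r]
  rw [integral_finsetSum _ fun p _ =>
    (integrable_mul_I_pow_spectralMeasure (p + r)).const_mul _, Complex.re_sum]
  push_cast
  refine Finset.sum_congr rfl fun p _ => ?_
  rw [integral_const_mul, ← Complex.ofReal_natCast, Complex.re_ofReal_mul,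
    re_integral_mul_I_pow_spectralMeasure]

section Expansions

variable {x : ℝ}

theorem hasSum_stirlingSum_div_ascPochhammer (hx : 0 < x) (r : ℕ) :
    HasSum (fun k => (stirlingSum (fun p => asymptoticCoeff (p + r)) k : ℚ) /
        (ascPochhammer ℝ (k + 1)).eval (x + 1))
      (∫ u : ℝ, (u * Complex.I) ^ r / (x - u * Complex.I) ∂spectralMeasure).re := by
  have integrable : Integrable (fun u : ℝ => ‖(u * Complex.I) ^ r‖ * Real.exp (Real.pi / 2 * |u|))
      spectralMeasure := by
    have half_pi_lt : |Real.pi / 2| < 2 * Real.pi := by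
      rw [abs_of_pos (by positivity)]
      linarith [Real.pi_pos]
    simpa using integrable_pow_mul_exp_spectralMeasure r half_pi_lt
  have hasSum := Complex.hasSum_re
    (hasSum_integral_mul_ascPochhammer_div (by fun_prop) integrable hx)
  simpa only [Complex.div_ofReal_re,
    re_integral_mul_I_pow_mul_ascPochhammer_spectralMeasure] using hasSum

theorem re_inv_sub_mul_I (x u : ℝ) : (1 / (x - u * Complex.I)).re = x / (x ^ 2 + u ^ 2) := by
  simp [Complex.normSq_apply, sq]

theorem integrable_inv_sub_mul_I (hx : 0 < x) :
    Integrable (fun u : ℝ => 1 / (x - u * Complex.I)) spectralMeasure := by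
  refine Integrable.mono' (g := fun u => x⁻¹ * u ^ 0)
    ((integrable_pow_spectralMeasure 0).const_mul _) ?_ (ae_of_all _ fun u => ?_)
  · exact (continuous_const.div (by fun_prop) (sub_mul_I_ne_zero hx)).aestronglyMeasurable
  · rw [norm_div, norm_one, one_div, pow_zero, mul_one]
    gcongr
    simpa [abs_of_pos hx] using Complex.abs_re_le_norm (x - u * Complex.I)

theorem re_integral_inv_sub_mul_I (hx : 0 < x) :
    (∫ u : ℝ, 1 / (x - u * Complex.I) ∂spectralMeasure).re =
      ∫ u, x / (x ^ 2 + u ^ 2) ∂spectralMeasure := by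
  simpa only [re_inv_sub_mul_I, RCLike.re_eq_complex_re] using
    (integral_re (integrable_inv_sub_mul_I hx)).symm

theorem re_integral_mul_I_div_sub_mul_I (hx : 0 < x) :
    (∫ u : ℝ, u * Complex.I / (x - u * Complex.I) ∂spectralMeasure).re =
      x * (∫ u, x / (x ^ 2 + u ^ 2) ∂spectralMeasure) - 1 / 24 := by
  have integrand (u : ℝ) : u * Complex.I / (x - u * Complex.I) =
      x * (1 / (x - u * Complex.I)) - (u * Complex.I) ^ 0 := by
    have := sub_mul_I_ne_zero hx u
    field_simp
    ring
  simp only [integrand]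
  rw [integral_sub ((integrable_inv_sub_mul_I hx).const_mul _)
    (integrable_mul_I_pow_spectralMeasure 0), integral_const_mul, Complex.sub_re,
    Complex.re_ofReal_mul, re_integral_inv_sub_mul_I hx, re_integral_mul_I_pow_spectralMeasure,
    asymptoticCoeff_zero]
  norm_num

theorem hasSum_coeffA_div_ascPochhammer (hx : 0 < x) :
    HasSum (fun k => (coeffA (k + 1) : ℝ) / (ascPochhammer ℝ (k + 1)).eval (x + 1))
      (∫ u, x / (x ^ 2 + u ^ 2) ∂spectralMeasure) := by
  simpa only [pow_zero, re_integral_inv_sub_mul_I hx, coeffA_succ, add_zero] using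
    hasSum_stirlingSum_div_ascPochhammer hx 0

theorem hasSum_coeffB_div_ascPochhammer (hx : 0 < x) :
    HasSum (fun k => (coeffB (k + 1) : ℝ) / (ascPochhammer ℝ (k + 1)).eval (x + 1))
      (x * (∫ u, x / (x ^ 2 + u ^ 2) ∂spectralMeasure) - 1 / 24) := by
  simpa only [pow_one, re_integral_mul_I_div_sub_mul_I hx, coeffB_succ] using
    hasSum_stirlingSum_div_ascPochhammer hx 1

theorem hasSum_coeffC_div_ascPochhammer (hx : 0 < x) :
    HasSum (fun k => (coeffC (k + 1) : ℝ) / (ascPochhammer ℝ (k + 1)).eval (x + 1))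
      ((1 / 2 + ∫ u, x / (x ^ 2 + u ^ 2) ∂spectralMeasure) / x) := by
  have recursion (k : ℕ) :
      (coeffC (k + 1 + 1) : ℝ) = (k + 1) * coeffC (k + 1) + coeffA (k + 1) := by
    exact_mod_cast coeffC_add_two k
  simpa [coeffC_values.1] using
    hasSum_div_ascPochhammer_of_recursion (c := fun k => (coeffC (k + 1) : ℝ)) hx recursion
      (hasSum_coeffA_div_ascPochhammer hx)

end Expansions

/-! ### The sum over the poles -/

theorem mul_I_mem_integerComplement {y : ℝ} (hy : y ≠ 0) :
    y * Complex.I ∈ Complex.integerComplement := by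
  rintro ⟨k, hk⟩
  exact hy (by simpa using (congrArg Complex.im hk).symm)

theorem cotTerm_mul_I {y : ℝ} (hy : y ≠ 0) (m : ℕ) :
    cotTerm (y * Complex.I) m =
      -(2 * y * Complex.I) * (1 / (y ^ 2 + (m + 1) ^ 2) : ℝ) := by
  have factorization : (y * Complex.I + (m + 1)) * (y * Complex.I - (m + 1)) =
      -(y ^ 2 + (m + 1) ^ 2) := by
    linear_combination (y : ℂ) ^ 2 * Complex.I_sq
  rw [cotTerm_identity (mul_I_mem_integerComplement hy), factorization, one_div_neg_eq_neg_one_div]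
  push_cast
  ring

theorem tsum_one_div_sq_add_succ_sq {y : ℝ} (hy : y ≠ 0) :
    ∑' m : ℕ, 1 / (y ^ 2 + ((m : ℝ) + 1) ^ 2) =
      Real.pi / (2 * y) *
        ((1 + Real.exp (-(2 * Real.pi * y))) / (1 - Real.exp (-(2 * Real.pi * y)))) -
      1 / (2 * y ^ 2) := by
  have exp_arg : Complex.exp (2 * Real.pi * Complex.I * (y * Complex.I)) =
      (Real.exp (-(2 * Real.pi * y)) : ℝ) := by
    rw [Complex.ofReal_exp]
    congr 1
    push_cast
    linear_combination 2 * Real.pi * y * Complex.I_sq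
  have exp_ne_one : (1 : ℂ) - (Real.exp (-(2 * Real.pi * y)) : ℝ) ≠ 0 := by
    rw [← Complex.ofReal_one, ← Complex.ofReal_sub, Complex.ofReal_ne_zero]
    exact sub_ne_zero.mpr (Ne.symm (by simp [hy, Real.pi_ne_zero]))
  have cot_series := cot_series_rep' (mul_I_mem_integerComplement hy)
  rw [Complex.cot_pi_eq_exp_ratio, exp_arg, tsum_congr (cotTerm_mul_I hy), tsum_mul_left,
    ← Complex.ofReal_tsum] at cot_series
  have hy' : (y : ℂ) ≠ 0 := Complex.ofReal_ne_zero.mpr hy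
  have hI := Complex.I_ne_zero
  apply Complex.ofReal_injective
  apply mul_left_cancel₀ (by simp [hy] : -(2 * y * Complex.I) ≠ 0)
  rw [← cot_series]
  generalize Real.exp (-(2 * Real.pi * y)) = E at *
  push_cast
  field_simp
  rw [Complex.I_sq]
  ring

/-- The partial fraction sum `∑ 1 / (s² + (freq m)²)` over the poles of `s ↦ 1 / (1 - exp (-s))` in
the upper half plane, which up to elementary factors is the subtracted Binet kernel
`1 / (1 - exp (-s)) - 1 / s - 1 / 2`. -/
noncomputable def poleSum (s : ℝ) : ℝ := ∑' m, 1 / (s ^ 2 + freq m ^ 2)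

theorem poleSum_eq {s : ℝ} (hs : s ≠ 0) :
    poleSum s = 1 / (4 * s) * ((1 + Real.exp (-s)) / (1 - Real.exp (-s)) - 2 / s) := by
  have summand (m : ℕ) : 1 / (s ^ 2 + freq m ^ 2) =
      1 / (4 * Real.pi ^ 2) * (1 / ((s / (2 * Real.pi)) ^ 2 + ((m : ℝ) + 1) ^ 2)) := by
    rw [freq]
    field_simp
    ring
  have cancel : 2 * Real.pi * (s / (2 * Real.pi)) = s := by field_simp
  rw [poleSum, tsum_congr summand, tsum_mul_left,
    tsum_one_div_sq_add_succ_sq (div_ne_zero hs (by positivity)), cancel]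
  generalize (1 + Real.exp (-s)) / (1 - Real.exp (-s)) = q
  field_simp

theorem integral_half_sub_mul_exp {s : ℝ} (hs : s ≠ 0) :
    ∫ t in (0 : ℝ)..1, (1 / 2 - t) * Real.exp (-(t * s)) =
      (1 + Real.exp (-s)) / (2 * s) - (1 - Real.exp (-s)) / s ^ 2 := by
  have primitive : ∀ t ∈ uIcc (0 : ℝ) 1, HasDerivAt
      (fun t : ℝ => ((t - 1 / 2) / s + 1 / s ^ 2) * Real.exp (-(t * s)))
      ((1 / 2 - t) * Real.exp (-(t * s))) t := by
    intro t _
    have deriv_poly : HasDerivAt (fun t : ℝ => (t - 1 / 2) / s + 1 / s ^ 2) (1 / s) t :=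
      (((hasDerivAt_id t).sub_const _).div_const s).add_const _
    have deriv_exp : HasDerivAt (fun t : ℝ => Real.exp (-(t * s)))
        (Real.exp (-(t * s)) * -(1 * s)) t :=
      ((hasDerivAt_id t).mul_const s).neg.exp
    refine (deriv_poly.mul deriv_exp).congr_deriv ?_
    field_simp
    ring
  rw [intervalIntegral.integral_eq_sub_of_hasDerivAt primitive
    (Continuous.intervalIntegrable (by fun_prop) _ _)]
  simp only [zero_mul, neg_zero, Real.exp_zero, one_mul]
  field_simp
  ring

theorem one_sub_exp_mul_poleSum {s : ℝ} (hs : s ≠ 0) :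
    (1 - Real.exp (-s)) * poleSum s =
      1 / 2 * ∫ t in (0 : ℝ)..1, (1 / 2 - t) * Real.exp (-(t * s)) := by
  have exp_ne_one : 1 - Real.exp (-s) ≠ 0 :=
    sub_ne_zero.mpr (Ne.symm (by simpa))
  rw [poleSum_eq hs, integral_half_sub_mul_exp hs]
  field_simp
  ring

section MellinTransform

variable {a c : ℝ}

theorem integral_rpow_mul_exp_neg_sq_add_sq_mul (ha : 0 < a) {t : ℝ} (ht : 0 < t) :
    ∫ s in Ioi (0 : ℝ), s ^ (a - 1) * Real.exp (-((s ^ 2 + c ^ 2) * t)) =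
      Real.Gamma (a / 2) / 2 * (t ^ (-(a / 2)) * Real.exp (-(c ^ 2 * t))) := by
  have integrand (s : ℝ) : s ^ (a - 1) * Real.exp (-((s ^ 2 + c ^ 2) * t)) =
      s ^ (a - 1) * Real.exp (-t * s ^ (2 : ℝ)) * Real.exp (-(c ^ 2 * t)) := by
    rw [mul_assoc, ← Real.exp_add, Real.rpow_two]
    ring_nf
  simp only [integrand]
  rw [integral_mul_const, integral_rpow_mul_exp_neg_mul_rpow two_pos (by linarith) ht,
    sub_add_cancel, neg_div]
  ring

theorem integrable_rpow_mul_exp_neg_sq_add_sq_mul (ha : 0 < a) (ha2 : a < 2) (hc : 0 < c) :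
    Integrable (Function.uncurry fun s t : ℝ => s ^ (a - 1) * Real.exp (-((s ^ 2 + c ^ 2) * t)))
      ((volume.restrict (Ioi 0)).prod (volume.restrict (Ioi 0))) := by
  have norm_integral : EqOn
      (fun t => ∫ s in Ioi (0 : ℝ), ‖s ^ (a - 1) * Real.exp (-((s ^ 2 + c ^ 2) * t))‖)
      (fun t => Real.Gamma (a / 2) / 2 * (t ^ (-(a / 2)) * Real.exp (-(c ^ 2 * t)))) (Ioi 0) := by
    intro t ht
    simp only [← integral_rpow_mul_exp_neg_sq_add_sq_mul ha ht]
    refine setIntegral_congr_fun measurableSet_Ioi fun s (hs : 0 < s) => ?_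
    exact Real.norm_of_nonneg (by positivity)
  rw [integrable_prod_iff' (by unfold Function.uncurry; fun_prop)]
  refine ⟨?_, IntegrableOn.congr_fun (.const_mul ?_ _) norm_integral.symm measurableSet_Ioi⟩
  · filter_upwards [ae_restrict_mem measurableSet_Ioi] with t ht
    refine not_imp_comm.mp integral_undef ?_
    simp only [Function.uncurry_apply_pair]
    rw [integral_rpow_mul_exp_neg_sq_add_sq_mul ha ht]
    have := Real.Gamma_pos_of_pos (half_pos ha)
    have : 0 < t := ht
    positivity
  · simpa only [IntegrableOn, Real.rpow_one, neg_mul] using integrableOn_rpow_mul_exp_neg_mul_rpow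
      (by linarith : -1 < -(a / 2)) one_pos (pow_pos hc 2)

theorem integral_rpow_mul_exp_neg_sq_add_sq_mul_right (hc : 0 < c) {s : ℝ} :
    ∫ t in Ioi (0 : ℝ), s ^ (a - 1) * Real.exp (-((s ^ 2 + c ^ 2) * t)) =
      s ^ (a - 1) / (s ^ 2 + c ^ 2) := by
  have pos : 0 < s ^ 2 + c ^ 2 := by positivity
  have exp_integral := integral_exp_mul_Ioi (neg_lt_zero.mpr pos) 0
  simp only [neg_mul] at exp_integral
  rw [integral_const_mul, exp_integral, mul_zero, neg_zero, Real.exp_zero, neg_div_neg_eq,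
    mul_one_div]

theorem integrableOn_rpow_div_sq_add_sq (ha : 0 < a) (ha2 : a < 2) (hc : 0 < c) :
    IntegrableOn (fun s : ℝ => s ^ (a - 1) / (s ^ 2 + c ^ 2)) (Ioi 0) := by
  simpa only [IntegrableOn, Function.uncurry_apply_pair,
    integral_rpow_mul_exp_neg_sq_add_sq_mul_right hc] using
    (integrable_rpow_mul_exp_neg_sq_add_sq_mul ha ha2 hc).integral_prod_left

/-- Write `1 / (s² + c²)` as the integral of `exp (-(s² + c²) t)` over `t` and integrate over `s`
first; the two gamma integrals combine by the reflection formula. -/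
theorem integral_rpow_div_sq_add_sq (ha : 0 < a) (ha2 : a < 2) (hc : 0 < c) :
    ∫ s in Ioi (0 : ℝ), s ^ (a - 1) / (s ^ 2 + c ^ 2) =
      Real.pi / (2 * Real.sin (Real.pi * (a / 2))) * c ^ (a - 2) := by
  calc ∫ s in Ioi (0 : ℝ), s ^ (a - 1) / (s ^ 2 + c ^ 2)
    _ = ∫ t in Ioi (0 : ℝ), ∫ s in Ioi (0 : ℝ),
          s ^ (a - 1) * Real.exp (-((s ^ 2 + c ^ 2) * t)) := by
      simp only [← integral_rpow_mul_exp_neg_sq_add_sq_mul_right hc]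
      exact integral_integral_swap (integrable_rpow_mul_exp_neg_sq_add_sq_mul ha ha2 hc)
    _ = ∫ t in Ioi (0 : ℝ), Real.Gamma (a / 2) / 2 *
          (t ^ (1 - a / 2 - 1) * Real.exp (-(c ^ 2 * t))) := by
      refine setIntegral_congr_fun measurableSet_Ioi fun t ht => ?_
      simp only [integral_rpow_mul_exp_neg_sq_add_sq_mul ha ht]
      ring_nf
    _ = Real.Gamma (a / 2) * Real.Gamma (1 - a / 2) / 2 * (1 / c ^ 2) ^ (1 - a / 2) := by
      rw [integral_const_mul, Real.integral_rpow_mul_exp_neg_mul_Ioi (by linarith) (by positivity)]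
      ring
    _ = Real.pi / (2 * Real.sin (Real.pi * (a / 2))) * c ^ (a - 2) := by
      rw [Real.Gamma_mul_Gamma_one_sub, one_div, ← Real.rpow_natCast, ← Real.rpow_neg hc.le,
        ← Real.rpow_mul hc.le, div_div, mul_comm _ (2 : ℝ)]
      push_cast
      ring_nf

end MellinTransform

/-! ### The remainder -/

theorem hasSum_zetaThreeHalves :
    HasSum (fun m : ℕ => 1 / ((m : ℝ) + 1) ^ (3 / 2 : ℝ)) zetaThreeHalves := by
  have summable : Summable fun m : ℕ => 1 / ((m : ℝ) + 1) ^ (3 / 2 : ℝ) := by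
    simpa only [Nat.cast_add_one] using (summable_nat_add_iff 1).mpr
      (Real.summable_one_div_nat_rpow.mpr (by norm_num : (1 : ℝ) < 3 / 2))
  have summand (m : ℕ) : 1 / ((m : ℂ) + 1) ^ (3 / 2 : ℂ) =
      (1 / ((m : ℝ) + 1) ^ (3 / 2 : ℝ) : ℝ) := by
    rw [Complex.ofReal_div, Complex.ofReal_cpow (by positivity)]
    push_cast
    rfl
  rw [zetaThreeHalves, zeta_eq_tsum_one_div_nat_add_one_cpow (by norm_num), tsum_congr summand,
    ← Complex.ofReal_tsum, Complex.ofReal_re]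
  exact summable.hasSum

theorem hasSum_freq_rpow :
    HasSum (fun m => freq m ^ (-3 / 2 : ℝ)) ((2 * Real.pi) ^ (-3 / 2 : ℝ) * zetaThreeHalves) := by
  refine (hasSum_zetaThreeHalves.mul_left _).congr_fun fun m => ?_
  rw [freq, Real.mul_rpow (by positivity) (by positivity), neg_div,
    Real.rpow_neg (by positivity : 0 ≤ (m : ℝ) + 1), one_div]

section MellinAtOneHalf

variable {c : ℝ}

theorem integrableOn_rpow_neg_half_div_sq_add_sq (hc : 0 < c) :
    IntegrableOn (fun s : ℝ => s ^ (-1 / 2 : ℝ) / (s ^ 2 + c ^ 2)) (Ioi 0) := by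
  convert integrableOn_rpow_div_sq_add_sq one_half_pos (by norm_num) hc using 5
  norm_num

theorem integral_rpow_neg_half_div_sq_add_sq (hc : 0 < c) :
    ∫ s in Ioi (0 : ℝ), s ^ (-1 / 2 : ℝ) / (s ^ 2 + c ^ 2) =
      Real.pi / √2 * c ^ (-3 / 2 : ℝ) := by
  have mellin := integral_rpow_div_sq_add_sq one_half_pos (by norm_num) hc
  have angle : Real.pi * (1 / 2 / 2) = Real.pi / 4 := by ring
  rw [angle, Real.sin_pi_div_four] at mellin
  convert mellin using 2
  · norm_num
  · field_simp
  · norm_num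

end MellinAtOneHalf

section LaplaceTransform

variable {x : ℝ}

theorem integrableOn_exp_neg_mul_mul (hx : 0 ≤ x) {g : ℝ → ℝ} (hg : IntegrableOn g (Ioi 0)) :
    IntegrableOn (fun s => Real.exp (-(x * s)) * g s) (Ioi 0) := by
  refine Integrable.bdd_mul (c := 1) hg (by fun_prop) ?_
  filter_upwards [ae_restrict_mem measurableSet_Ioi] with s (hs : 0 < s)
  rw [Real.norm_of_nonneg (Real.exp_nonneg _), Real.exp_le_one_iff, neg_nonpos]
  positivity

theorem integral_norm_exp_neg_mul_mul_le (hx : 0 ≤ x) (m : ℕ) :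
    ∫ s in Ioi (0 : ℝ), ‖Real.exp (-(x * s)) * (s ^ (-1 / 2 : ℝ) / (s ^ 2 + freq m ^ 2))‖ ≤
      Real.pi / √2 * freq m ^ (-3 / 2 : ℝ) := by
  have integrable := integrableOn_rpow_neg_half_div_sq_add_sq (freq_pos m)
  rw [← integral_rpow_neg_half_div_sq_add_sq (freq_pos m)]
  refine setIntegral_mono_on (integrableOn_exp_neg_mul_mul hx integrable).norm integrable
    measurableSet_Ioi fun s (hs : 0 < s) => ?_
  rw [Real.norm_of_nonneg (by positivity)]
  refine mul_le_of_le_one_left (by positivity) ?_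
  rw [Real.exp_le_one_iff, neg_nonpos]
  positivity

theorem hasSum_integral_exp_neg_mul_mul_poleSum (hx : 0 ≤ x) :
    HasSum (fun m => ∫ s in Ioi (0 : ℝ),
        Real.exp (-(x * s)) * (s ^ (-1 / 2 : ℝ) / (s ^ 2 + freq m ^ 2)))
      (∫ s in Ioi (0 : ℝ), Real.exp (-(x * s)) * (s ^ (-1 / 2 : ℝ) * poleSum s)) := by
  have hasSum := hasSum_integral_of_summable_integral_norm
    (fun m => integrableOn_exp_neg_mul_mul hx
      (integrableOn_rpow_neg_half_div_sq_add_sq (freq_pos m)))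
    (.of_nonneg_of_le (fun m => integral_nonneg fun _ => norm_nonneg _)
      (integral_norm_exp_neg_mul_mul_le hx) (hasSum_freq_rpow.summable.mul_left _))
  simpa only [poleSum, ← tsum_mul_left, mul_one_div] using hasSum

end LaplaceTransform

/-- The difference between `∑ k ≤ x, √k` and the terms `⅔ x^(3/2) + ½ √x - ζ(3/2) / (4π)`, written
as a Laplace transform so that it makes sense for every real `x ≥ 0`. -/
noncomputable def sqrtRemainder (x : ℝ) : ℝ :=
  (√Real.pi)⁻¹ * ∫ s in Ioi (0 : ℝ), Real.exp (-(x * s)) * (s ^ (-1 / 2 : ℝ) * poleSum s)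

theorem hasSum_integral_rpow_neg_half_mul_poleSum :
    HasSum (fun m => Real.pi / √2 * freq m ^ (-3 / 2 : ℝ))
      (∫ s in Ioi (0 : ℝ), s ^ (-1 / 2 : ℝ) * poleSum s) := by
  simpa only [zero_mul, neg_zero, Real.exp_zero, one_mul,
    integral_rpow_neg_half_div_sq_add_sq (freq_pos _)] using
    hasSum_integral_exp_neg_mul_mul_poleSum le_rfl

theorem integrableOn_rpow_neg_half_mul_poleSum :
    IntegrableOn (fun s => s ^ (-1 / 2 : ℝ) * poleSum s) (Ioi 0) := by
  have term_pos (m : ℕ) : 0 < Real.pi / √2 * freq m ^ (-3 / 2 : ℝ) := by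
    have := freq_pos m
    positivity
  -- The Bochner integral of a nonintegrable function is `0`, and this one is positive.
  refine not_imp_comm.mp integral_undef (ne_of_gt ?_)
  rw [← hasSum_integral_rpow_neg_half_mul_poleSum.tsum_eq]
  exact hasSum_integral_rpow_neg_half_mul_poleSum.summable.tsum_pos
    (fun m => (term_pos m).le) 0 (term_pos 0)

theorem sqrtRemainder_zero : sqrtRemainder 0 = 1 / (4 * Real.pi) * zetaThreeHalves := by
  have two_pi_rpow : (2 * Real.pi) ^ (-3 / 2 : ℝ) = (2 * Real.pi)⁻¹ * (√2 * √Real.pi)⁻¹ := by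
    rw [← Real.sqrt_mul zero_le_two, Real.sqrt_eq_rpow, ← Real.rpow_neg (by positivity),
      ← Real.rpow_neg_one, ← Real.rpow_add (by positivity)]
    norm_num
  simp only [sqrtRemainder, zero_mul, neg_zero, Real.exp_zero, one_mul]
  rw [hasSum_integral_rpow_neg_half_mul_poleSum.unique (hasSum_freq_rpow.mul_left _), two_pi_rpow]
  have sqrt_two_sq : √2 ^ 2 = (2 : ℝ) := Real.sq_sqrt zero_le_two
  have sqrt_pi_sq : √Real.pi ^ 2 = Real.pi := Real.sq_sqrt Real.pi_pos.le
  field_simp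
  rw [sqrt_two_sq, sqrt_pi_sq]
  ring

section Rescaling

variable {x : ℝ}

theorem integral_exp_neg_mul_mul_rpow_neg_half_div (hx : 0 < x) {c : ℝ} (hc : 0 < c) :
    (√Real.pi)⁻¹ * ∫ s in Ioi (0 : ℝ),
        Real.exp (-(x * s)) * (s ^ (-1 / 2 : ℝ) / (s ^ 2 + c ^ 2)) =
      √x * ((c ^ 2)⁻¹ * ∫ u, x / (x ^ 2 + u ^ 2) ∂gammaMeasure (1 / 2) c) := by
  have rescaled := integral_comp_mul_gammaMeasure (f := fun s => 1 / (s ^ 2 + c ^ 2))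
    one_half_pos hx (div_pos hc hx)
  have integrand (u : ℝ) : 1 / ((c / x * u) ^ 2 + c ^ 2) =
      x * (c ^ 2)⁻¹ * (x / (x ^ 2 + u ^ 2)) := by
    field_simp
    ring
  have gamma_integrand (s : ℝ) :
      s ^ (1 / 2 - 1 : ℝ) * Real.exp (-(x * s)) * (1 / (s ^ 2 + c ^ 2)) =
        Real.exp (-(x * s)) * (s ^ (-1 / 2 : ℝ) / (s ^ 2 + c ^ 2)) := by
    rw [show (1 / 2 - 1 : ℝ) = -1 / 2 by norm_num]
    ring
  simp only [integrand, integral_const_mul, div_mul_cancel₀ c hx.ne'] at rescaled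
  rw [integral_gammaMeasure one_half_pos hx, ← Real.sqrt_eq_rpow,
    Real.Gamma_one_half_eq] at rescaled
  simp only [gamma_integrand] at rescaled
  apply mul_left_cancel₀ (Real.sqrt_pos.mpr hx).ne'
  have sq_sqrt : √x * √x = x := Real.mul_self_sqrt hx.le
  linear_combination -rescaled -
    (c ^ 2)⁻¹ * (∫ u, x / (x ^ 2 + u ^ 2) ∂gammaMeasure (1 / 2) c) * sq_sqrt

theorem sqrtRemainder_eq_sqrt_mul_integral (hx : 0 < x) :
    sqrtRemainder x = √x * ∫ u, x / (x ^ 2 + u ^ 2) ∂spectralMeasure := by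
  have integrable : Integrable (fun u => x / (x ^ 2 + u ^ 2)) spectralMeasure := by
    simpa only [RCLike.re_eq_complex_re, re_inv_sub_mul_I] using (integrable_inv_sub_mul_I hx).re
  refine ((hasSum_integral_exp_neg_mul_mul_poleSum hx.le).mul_left _).unique ?_
  simpa only [integral_exp_neg_mul_mul_rpow_neg_half_div hx (freq_pos _)] using
    (hasSum_integral_spectralMeasure integrable).mul_left _

end Rescaling

section Difference

variable {x : ℝ}

theorem integral_exp_neg_mul_mul_rpow_neg_half (hx : 0 < x) :
    ∫ s in Ioi (0 : ℝ), Real.exp (-(x * s)) * s ^ (-1 / 2 : ℝ) =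
      √Real.pi * x ^ (-1 / 2 : ℝ) := by
  have gamma := Real.integral_rpow_mul_exp_neg_mul_Ioi one_half_pos hx
  rw [Real.Gamma_one_half_eq, one_div x, Real.inv_rpow hx.le, ← Real.rpow_neg hx.le] at gamma
  rw [← neg_div, mul_comm] at gamma
  rw [← gamma]
  refine integral_congr_ae (ae_of_all _ fun s => ?_)
  ring_nf

theorem intervalIntegrable_add_rpow_neg_half (x : ℝ) :
    IntervalIntegrable (fun t => (x + t) ^ (-1 / 2 : ℝ)) volume 0 1 := by
  simpa using (intervalIntegral.intervalIntegrable_rpow' (a := x) (b := x + 1)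
    (by norm_num : -1 < (-1 / 2 : ℝ))).comp_add_left x

theorem integral_half_sub_mul_rpow_neg_half (hx : 0 ≤ x) :
    ∫ t in (0 : ℝ)..1, (1 / 2 - t) * (x + t) ^ (-1 / 2 : ℝ) =
      4 / 3 * ((x + 1) * √(x + 1) - x * √x) - (√(x + 1) + √x) := by
  have primitive : ∀ t ∈ Ioo (0 : ℝ) 1, HasDerivAt
      (fun t => (1 - 2 * t) * √(x + t) + 4 / 3 * ((x + t) * √(x + t)))
      ((1 / 2 - t) * (x + t) ^ (-1 / 2 : ℝ)) t := by
    intro t ht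
    have pos : 0 < x + t := add_pos_of_nonneg_of_pos hx ht.1
    have deriv_add : HasDerivAt (fun t => x + t) 1 t := (hasDerivAt_id t).const_add x
    have deriv_sqrt : HasDerivAt (fun t => √(x + t)) (1 / (2 * √(x + t))) t :=
      deriv_add.sqrt pos.ne'
    have deriv_linear : HasDerivAt (fun t : ℝ => 1 - 2 * t) (-(2 * 1)) t :=
      ((hasDerivAt_id t).const_mul 2).const_sub 1
    refine ((deriv_linear.mul deriv_sqrt).add
      ((deriv_add.mul deriv_sqrt).const_mul (4 / 3))).congr_deriv ?_
    rw [neg_div, Real.rpow_neg pos.le, ← Real.sqrt_eq_rpow]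
    field_simp
    rw [Real.sq_sqrt pos.le]
    ring
  rw [intervalIntegral.integral_eq_sub_of_hasDerivAt_of_le zero_le_one (by fun_prop) primitive
    ((intervalIntegrable_add_rpow_neg_half x).continuousOn_mul (by fun_prop))]
  simp only [add_zero]
  ring

theorem integrable_half_sub_mul_exp_mul_rpow_neg_half (hx : 0 ≤ x) :
    Integrable (Function.uncurry fun t s : ℝ =>
        (1 / 2 - t) * (Real.exp (-((x + t) * s)) * s ^ (-1 / 2 : ℝ)))
      ((volume.restrict (uIoc 0 1)).prod (volume.restrict (Ioi 0))) := by
  have norm_integral : EqOn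
      (fun t => ∫ s in Ioi (0 : ℝ), ‖(1 / 2 - t) * (Real.exp (-((x + t) * s)) * s ^ (-1 / 2 : ℝ))‖)
      (fun t => |1 / 2 - t| * (√Real.pi * (x + t) ^ (-1 / 2 : ℝ))) (Ioc 0 1) := by
    intro t ht
    simp only [← integral_exp_neg_mul_mul_rpow_neg_half (add_pos_of_nonneg_of_pos hx ht.1),
      ← integral_const_mul]
    refine setIntegral_congr_fun measurableSet_Ioi fun s (hs : 0 < s) => ?_
    rw [norm_mul, Real.norm_eq_abs, Real.norm_of_nonneg (by positivity)]
  rw [uIoc_of_le zero_le_one, integrable_prod_iff (by unfold Function.uncurry; fun_prop)]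
  constructor
  · filter_upwards [ae_restrict_mem measurableSet_Ioc] with t ht
    have pos : 0 < x + t := add_pos_of_nonneg_of_pos hx ht.1
    have integrable :
        IntegrableOn (fun s => Real.exp (-((x + t) * s)) * s ^ (-1 / 2 : ℝ)) (Ioi 0) := by
      refine not_imp_comm.mp integral_undef ?_
      rw [integral_exp_neg_mul_mul_rpow_neg_half pos]
      positivity
    exact integrable.const_mul (1 / 2 - t)
  · refine IntegrableOn.congr_fun ?_ norm_integral.symm measurableSet_Ioc
    exact (intervalIntegrable_iff_integrableOn_Ioc_of_le zero_le_one).mp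
      (((intervalIntegrable_add_rpow_neg_half x).const_mul _).continuousOn_mul (by fun_prop))

theorem exp_neg_mul_mul_poleSum_sub_exp_neg_add_one_mul_mul_poleSum (x : ℝ) {s : ℝ} (hs : s ≠ 0) :
    Real.exp (-(x * s)) * (s ^ (-1 / 2 : ℝ) * poleSum s) -
        Real.exp (-((x + 1) * s)) * (s ^ (-1 / 2 : ℝ) * poleSum s) =
      1 / 2 * ∫ t in (0 : ℝ)..1,
        (1 / 2 - t) * (Real.exp (-((x + t) * s)) * s ^ (-1 / 2 : ℝ)) := by
  have exp_add (t : ℝ) : Real.exp (-((x + t) * s)) = Real.exp (-(x * s)) * Real.exp (-(t * s)) := by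
    rw [← Real.exp_add]
    ring_nf
  have integrand (t : ℝ) : (1 / 2 - t) * (Real.exp (-((x + t) * s)) * s ^ (-1 / 2 : ℝ)) =
      Real.exp (-(x * s)) * s ^ (-1 / 2 : ℝ) * ((1 / 2 - t) * Real.exp (-(t * s))) := by
    rw [exp_add]
    ring
  simp only [integrand, intervalIntegral.integral_const_mul]
  rw [exp_add, one_mul]
  linear_combination Real.exp (-(x * s)) * s ^ (-1 / 2 : ℝ) * one_sub_exp_mul_poleSum hs

theorem sqrtRemainder_sub_sqrtRemainder_add_one (hx : 0 ≤ x) :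
    sqrtRemainder x - sqrtRemainder (x + 1) =
      2 / 3 * ((x + 1) * √(x + 1) - x * √x) - 1 / 2 * (√(x + 1) + √x) := by
  have inner_integral : ∀ t ∈ uIoc (0 : ℝ) 1, ∫ s in Ioi (0 : ℝ),
      (1 / 2 - t) * (Real.exp (-((x + t) * s)) * s ^ (-1 / 2 : ℝ)) =
        √Real.pi * ((1 / 2 - t) * (x + t) ^ (-1 / 2 : ℝ)) := by
    intro t ht
    rw [uIoc_of_le zero_le_one] at ht
    rw [integral_const_mul,
      integral_exp_neg_mul_mul_rpow_neg_half (add_pos_of_nonneg_of_pos hx ht.1)]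
    ring
  rw [sqrtRemainder, sqrtRemainder, ← mul_sub, ← integral_sub
    (integrableOn_exp_neg_mul_mul hx integrableOn_rpow_neg_half_mul_poleSum)
    (integrableOn_exp_neg_mul_mul (by positivity) integrableOn_rpow_neg_half_mul_poleSum),
    setIntegral_congr_fun measurableSet_Ioi fun s hs =>
      exp_neg_mul_mul_poleSum_sub_exp_neg_add_one_mul_mul_poleSum x (ne_of_gt hs),
    integral_const_mul,
    ← intervalIntegral_integral_swap (integrable_half_sub_mul_exp_mul_rpow_neg_half hx),
    intervalIntegral.integral_congr_ae (ae_of_all _ inner_integral),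
    intervalIntegral.integral_const_mul, integral_half_sub_mul_rpow_neg_half hx]
  field_simp
  ring

end Difference

theorem sum_sqrt_eq (n : ℕ) :
    ∑ k ∈ Finset.range (n + 1), √(k : ℝ) =
      2 / 3 * (n : ℝ) ^ (3 / 2 : ℝ) + 1 / 2 * √n - 1 / (4 * Real.pi) * zetaThreeHalves +
        sqrtRemainder n := by
  have rpow_three_halves {x : ℝ} (hx : 0 ≤ x) : x ^ (3 / 2 : ℝ) = x * √x := by
    rw [Real.sqrt_eq_rpow, ← Real.rpow_one_add' hx (by norm_num)]
    norm_num
  induction n with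
  | zero => simp [sqrtRemainder_zero]
  | succ n ih =>
    have hn : (0 : ℝ) ≤ n := n.cast_nonneg
    rw [Finset.sum_range_succ, ih, Nat.cast_add_one, rpow_three_halves hn,
      rpow_three_halves (by positivity)]
    linear_combination sqrtRemainder_sub_sqrtRemainder_add_one hn

section Expansions

theorem risingProd_eq_ascPochhammer (n k : ℕ) :
    risingProd n k = (ascPochhammer ℝ k).eval (n + 1 : ℝ) := by
  induction k with
  | zero => simp [risingProd]
  | succ k ih =>
    rw [ascPochhammer_succ_eval, ← ih, risingProd, Finset.prod_Icc_succ_top (by lia), risingProd,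
      Nat.cast_add_one]
    ring

variable {n : ℕ}

theorem hasSum_coeffA_div_risingProd (hn : 0 < n) :
    HasSum (fun k => (coeffA (k + 1) : ℝ) / risingProd n (k + 1)) (sqrtRemainder n / √n) := by
  have hn' : (0 : ℝ) < n := Nat.cast_pos.mpr hn
  rw [sqrtRemainder_eq_sqrt_mul_integral hn',
    mul_div_cancel_left₀ _ (Real.sqrt_pos.mpr hn').ne']
  simpa only [risingProd_eq_ascPochhammer] using hasSum_coeffA_div_ascPochhammer hn'

theorem hasSum_coeffB_div_risingProd (hn : 0 < n) :
    HasSum (fun k => (coeffB (k + 1) : ℝ) / (√n * risingProd n (k + 1)))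
      (sqrtRemainder n - 1 / (24 * √n)) := by
  have hn' : (0 : ℝ) < n := Nat.cast_pos.mpr hn
  have value_eq : (n * (∫ u, n / (n ^ 2 + u ^ 2) ∂spectralMeasure) - 1 / 24) / √n =
      sqrtRemainder n - 1 / (24 * √n) := by
    rw [sqrtRemainder_eq_sqrt_mul_integral hn', sub_div, mul_div_right_comm, Real.div_sqrt, div_div]
  simpa only [risingProd_eq_ascPochhammer, div_div, mul_comm (√(n : ℝ)), value_eq] using
    (hasSum_coeffB_div_ascPochhammer hn').div_const √n

theorem hasSum_coeffC_div_risingProd (hn : 0 < n) :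
    HasSum (fun k => (coeffC (k + 1) : ℝ) / risingProd n (k + 1))
      ((1 / 2 * √n + sqrtRemainder n) / (n * √n)) := by
  have hn' : (0 : ℝ) < n := Nat.cast_pos.mpr hn
  convert hasSum_coeffC_div_ascPochhammer hn' using 1
  · simp only [risingProd_eq_ascPochhammer]
  · rw [sqrtRemainder_eq_sqrt_mul_integral hn']
    field_simp

end Expansions

end SqrtSum

open SqrtSum

/-- The infinite sums over `k ≥ 1` are written as sums over `k : ℕ` of the term with index `k + 1`. -/
theorem mainTheorem5 :
    (∀ n : ℕ, 1 ≤ n →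
      (Summable (fun k : ℕ => (SqrtSum.coeffA (k + 1) : ℝ) / SqrtSum.risingProd n (k + 1)) ∧
        ∑ k ∈ Finset.range (n + 1), Real.sqrt (k : ℝ) =
          2 / 3 * (n : ℝ) ^ (3 / 2 : ℝ) + 1 / 2 * Real.sqrt n
            - 1 / (4 * Real.pi) * SqrtSum.zetaThreeHalves
            + Real.sqrt n *
              ∑' k : ℕ, (SqrtSum.coeffA (k + 1) : ℝ) / SqrtSum.risingProd n (k + 1)) ∧
      (Summable (fun k : ℕ =>
          (SqrtSum.coeffB (k + 1) : ℝ) / (Real.sqrt n * SqrtSum.risingProd n (k + 1))) ∧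
        ∑ k ∈ Finset.range (n + 1), Real.sqrt (k : ℝ) =
          2 / 3 * (n : ℝ) ^ (3 / 2 : ℝ) + 1 / 2 * Real.sqrt n
            - 1 / (4 * Real.pi) * SqrtSum.zetaThreeHalves
            + 1 / (24 * Real.sqrt n)
            + ∑' k : ℕ,
              (SqrtSum.coeffB (k + 1) : ℝ) / (Real.sqrt n * SqrtSum.risingProd n (k + 1))) ∧
      (Summable (fun k : ℕ => (SqrtSum.coeffC (k + 1) : ℝ) / SqrtSum.risingProd n (k + 1)) ∧
        ∑ k ∈ Finset.range (n + 1), Real.sqrt (k : ℝ) =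
          2 / 3 * (n : ℝ) ^ (3 / 2 : ℝ)
            - 1 / (4 * Real.pi) * SqrtSum.zetaThreeHalves
            + (n : ℝ) * Real.sqrt n *
              ∑' k : ℕ, (SqrtSum.coeffC (k + 1) : ℝ) / SqrtSum.risingProd n (k + 1))) ∧
    (SqrtSum.coeffA 1 = 1 / 24 ∧ SqrtSum.coeffA 2 = 1 / 24 ∧
      SqrtSum.coeffA 3 = 53 / 640 ∧ SqrtSum.coeffA 4 = 79 / 320) ∧
    (SqrtSum.coeffB 1 = 0 ∧ SqrtSum.coeffB 2 = -1 / 1920 ∧ SqrtSum.coeffB 3 = -1 / 640 ∧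
      SqrtSum.coeffB 4 = -259 / 46080 ∧ SqrtSum.coeffB 5 = -115 / 4608) ∧
    (SqrtSum.coeffC 1 = 1 / 2 ∧ SqrtSum.coeffC 2 = 13 / 24 ∧
      SqrtSum.coeffC 3 = 9 / 8 ∧ SqrtSum.coeffC 4 = 2213 / 640) := by
  refine ⟨fun n hn => ?_, coeffA_values, coeffB_values, coeffC_values⟩
  have expansionA := hasSum_coeffA_div_risingProd hn
  have expansionB := hasSum_coeffB_div_risingProd hn
  have expansionC := hasSum_coeffC_div_risingProd hn
  have sqrt_pos : 0 < √(n : ℝ) := Real.sqrt_pos.mpr (Nat.cast_pos.mpr hn)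
  rw [sum_sqrt_eq, expansionA.tsum_eq, expansionB.tsum_eq, expansionC.tsum_eq]
  refine ⟨⟨expansionA.summable, ?_⟩, ⟨expansionB.summable, ?_⟩, expansionC.summable, ?_⟩
  · rw [mul_div_cancel₀ _ sqrt_pos.ne']
  · ring
  · rw [mul_div_cancel₀ _ (by positivity)]
    ring
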